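/- **Theorem (retire() is wait-free bounded).** Consider the Wait-Free Eras (WFE) memory reclamation scheme, given below, run by $n$ threads with $H$ (= max\_hes) reservations per thread on a sequentially consistent shared memory, under an arbitrary (asynchronous) schedule. A step is one atomic access to shared memory (load, store, fetch-and-add F&A, compare-and-swap, or wide compare-and-swap WCAS of a pair) with adjacent thread-local work. Eras, tags and counters are unbounded natural numbers; system allocation and freeing of a block are single steps. Between its calls to the scheme a thread runs arbitrary application code, which may write any reference (never **invptr**) to any application cell. There are constants $B$ and $C$ that depend only on $n$ and $H$ such that, in every execution, every call of retire() by a thread $t$ returns within $B + C\cdot r$ steps of $t$, where $r$ is the length of $t$'s own retire\_list (the blocks retired by $t$ and not yet freed) when the call starts. Here the other threads may take any number of steps, do anything that the interface allows, and be delayed or stopped forever; and $t$ is never blocked, i.e. it can take a step at every moment before the call returns. The constants do not depend on the execution, on the application, or on the tuning constants era\_freq, cleanup\_freq, max\_attempts. *Shared data.* global\_era ($=1$ initially); counter\_start, counter\_end ($=0$); for each thread $i$ pairs reservations$[i][0..H+1]$ = (A: era, B: tag) (initially $(\infty,0)$), where the entries $H$ and $H+1$ are the first and second special reservations; for each thread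 $i$ and $j<H$ a record state$[i][j]$ = (pointer, era, result), where result = (A: pointer, B: era or tag) (initially $(\mathbf{nullptr},\infty)$). Each block has fields alloc\_era and retire\_era. Each thread has a local retire\_list (initially empty), alloc\_counter and retire\_counter (initially 0). Below, tid is the executing thread. *retire(b):* b.retire\_era := e := global\_era; append b to retire\_list; if retire\_counter++ mod cleanup\_freq $=0$: {if e = global\_era then increment\_era(); cleanup()}. *increment\_era():* ce := counter\_end; cs := counter\_start; if ce $\ne$ cs then for all $i<n$, $j<H$: if state$[i][j]$.result.A = invptr then help\_thread($i,j$). Finally F&A(global\_era, 1). *help\_thread(i,j):* last := state$[i][j]$.result; return if last.A $\ne$ invptr. reservations[tid][H].A := state$[i][j]$.era; ptr := state$[i][j]$.pointer; tag := reservations$[i][j]$.B. If tag = last.B: {prev := global\_era; repeat: reservations[tid][H+1].A := prev; ret := *ptr; new := global\_era; if prev = new: {if WCAS(state$[i][j]$.result, last, (ret, new)) succeeds then repeat {old := reservations$[i][j]$; stop if old.B $\ne$ tag} until WCAS(reservations$[i][j]$, old, (new, tag+1)) succeeds; leave the outer loop}; prev := new; while state$[i][j]$.result = last. Then reservations[tid][H+1].A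 := $\infty$}. Finally reservations[tid][H].A := $\infty$. *cleanup():* for each b in retire\_list: ce := counter\_end; if no conflict is found in a scan of the normal reservations $[0..H-1]$ of all threads and then of the first special reservation of all threads, and if moreover either ce = counter\_start or no conflict is found in a scan of the second special reservation of all threads and then of the normal reservations of all threads, then free b and remove it from retire\_list. A reservation conflicts with b if its era e is $\ne\infty$ and b.alloc\_era $\le$ e $\le$ b.retire\_era. *alloc\_block():* if alloc\_counter++ mod era\_freq $=0$ then increment\_era(); allocate b; b.alloc\_era := global\_era; return b. *clear():* reservations[tid][j].A := $\infty$ for all $j<H$. *get\_protected(ptr, j, parent)* with $j<H$: prev := reservations[tid][j].A. Fast path, repeated up to max\_attempts times: ret := *ptr; new := global\_era; return ret if prev = new; reservations[tid][j].A := new; prev := new. Slow path: pe := parent.alloc\_era ($\infty$ if parent = nullptr); F&A(counter\_start, 1); state[tid][j].pointer := ptr; state[tid][j].era := pe; tag := reservations[tid][j].B; state[tid][j].result := (invptr, tag). Repeat: ret := *ptr; new := global\_era; if prev = new and WCAS(state[tid][j].result, (invptr, tag), (nullptr, $\infty$)) succeeds then {reservations[tid][j].B := tag+1; F&A(counter\_end,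 1); return ret}; WCAS(reservations[tid][j], (prev, tag), (new, tag)); prev := new; p := state[tid][j].result.A; while p = invptr. Then reservations[tid][j].A := state[tid][j].result.B; reservations[tid][j].B := tag+1; F&A(counter\_end, 1); return p. -/

import Mathlib

/-!
The Wait-Free Eras (WFE) memory reclamation scheme as a transition system over a sequentially
consistent shared memory: `n` threads, `H` (that is, max_hes) reservations per thread.
Every transition of a thread performs at most one access to shared memory (load, store,
fetch-and-add, CAS or wide CAS) together with thread-local work.
Eras, tags and counters are unbounded natural numbers (no 64-bit overflow).
Addresses of blocks and of memory cells are natural numbers.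
-/

namespace WFE

/-- Tuning constants: how often `alloc_block` advances the era, how often `retire` runs
`cleanup`, and the number of attempts on the fast path of `get_protected`. -/
structure Params where
  eraFreq : ℕ
  cleanupFreq : ℕ
  maxAttempts : ℕ

/-- The pointer component of a `result` pair: the reserved value `invptr`, or a pointer that data
structures may store, where `ptr none` is `nullptr` and `ptr (some b)` points to the block `b`. -/
inductive ResPtr where
  | inv
  | ptr (p : Option ℕ)
  deriving DecidableEq

/-- The pair `result`: `(invptr, tag)` as input, `(pointer, era)` as output. -/
structure Result where
  A : ResPtr
  B : ℕ∞
  deriving DecidableEq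

/-- An entry of the array `reservations`: an era (`⊤` if nothing is reserved) and a tag. -/
structure Resv where
  A : ℕ∞
  B : ℕ
  deriving DecidableEq

/-- The slow-path `state` of one reservation: address of the hazardous reference, allocation era of
the parent block, and the `result` pair. -/
structure Slot where
  pointer : ℕ
  era : ℕ∞
  result : Result

/-- The operations that call `increment_era`. -/
inductive Caller where
  | alloc
  | retire

/-- Arguments of `get_protected`: address of the hazardous reference, index of the reservation,
parent block (`none` for `nullptr`). -/
structure GPArgs (H : ℕ) where
  ptr : ℕ
  index : Fin H
  parent : Option ℕ

/-- Activation record of `help_thread(i, j)` called within `increment_era`: the operation that called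
`increment_era`, and the entries of `state` that `increment_era` has still to visit afterwards. -/
structure HelpCtx (n H : ℕ) where
  caller : Caller
  i : Fin n
  j : Fin H
  rest : List (Fin n × Fin H)

/-- Program points of a thread, with the values of the local variables that are live there. -/
inductive PC (n H : ℕ) where
  /-- outside of the reclamation interface, running application code -/
  | idle
  -- get_protected, fast path
  | gpEnter (a : GPArgs H)
  | gpFastRead (a : GPArgs H) (attempts : ℕ) (prev : ℕ∞)
  | gpFastEra (a : GPArgs H) (attempts : ℕ) (prev : ℕ∞) (ret : Option ℕ)
  | gpFastPublish (a : GPArgs H) (attempts : ℕ) (new : ℕ)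
  -- get_protected, slow path
  | gpParent (a : GPArgs H) (prev : ℕ∞)
  | gpStart (a : GPArgs H) (prev : ℕ∞) (parentEra : ℕ∞)
  | gpSetPointer (a : GPArgs H) (prev : ℕ∞) (parentEra : ℕ∞)
  | gpSetEra (a : GPArgs H) (prev : ℕ∞) (parentEra : ℕ∞)
  | gpTag (a : GPArgs H) (prev : ℕ∞)
  | gpRequest (a : GPArgs H) (prev : ℕ∞) (tag : ℕ)
  | gpRead (a : GPArgs H) (prev : ℕ∞) (tag : ℕ)
  | gpEra (a : GPArgs H) (prev : ℕ∞) (tag : ℕ) (ret : Option ℕ)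
  | gpCancel (a : GPArgs H) (prev : ℕ∞) (tag : ℕ) (ret : Option ℕ) (new : ℕ)
  | gpCancelTag (a : GPArgs H) (tag : ℕ) (ret : Option ℕ)
  | gpCancelEnd (a : GPArgs H) (ret : Option ℕ)
  | gpUpdate (a : GPArgs H) (prev : ℕ∞) (tag : ℕ) (new : ℕ)
  | gpCheck (a : GPArgs H) (prev : ℕ∞) (tag : ℕ)
  | gpOutEra (a : GPArgs H) (tag : ℕ) (p : Option ℕ)
  | gpOutSetEra (a : GPArgs H) (tag : ℕ) (p : Option ℕ) (era : ℕ∞)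
  | gpOutSetTag (a : GPArgs H) (tag : ℕ) (p : Option ℕ)
  | gpOutEnd (a : GPArgs H) (p : Option ℕ)
  -- clear
  | clear (j : Fin H) (rest : List (Fin H))
  -- alloc_block
  | alEnter
  | alMalloc
  | alEra (b : ℕ)
  | alSetEra (b : ℕ) (era : ℕ)
  -- retire
  | rtEnter (b : ℕ)
  | rtSetEra (b : ℕ) (era : ℕ)
  | rtAppend (b : ℕ) (era : ℕ)
  | rtCheck (era : ℕ)
  -- increment_era
  | ieEnd (f : Caller)
  | ieStart (f : Caller) (ce : ℕ)
  | ieScan (f : Caller) (i : Fin n) (j : Fin H) (rest : List (Fin n × Fin H))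
  | ieAdd (f : Caller)
  -- help_thread
  | htResult (f : HelpCtx n H)
  | htParentEra (f : HelpCtx n H) (last : Result)
  | htParentPublish (f : HelpCtx n H) (last : Result) (parentEra : ℕ∞)
  | htPointer (f : HelpCtx n H) (last : Result)
  | htTag (f : HelpCtx n H) (last : Result) (ptr : ℕ)
  | htEra (f : HelpCtx n H) (last : Result) (ptr : ℕ) (tag : ℕ)
  | htPublish (f : HelpCtx n H) (last : Result) (ptr : ℕ) (tag : ℕ) (prev : ℕ)
  | htRead (f : HelpCtx n H) (last : Result) (ptr : ℕ) (tag : ℕ) (prev : ℕ)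
  | htReread (f : HelpCtx n H) (last : Result) (ptr : ℕ) (tag : ℕ) (prev : ℕ) (ret : Option ℕ)
  | htOutput (f : HelpCtx n H) (last : Result) (tag : ℕ) (ret : Option ℕ) (era : ℕ)
  | htHandLoad (f : HelpCtx n H) (tag : ℕ) (era : ℕ)
  | htHandSwap (f : HelpCtx n H) (tag : ℕ) (era : ℕ) (old : Resv)
  | htLoop (f : HelpCtx n H) (last : Result) (ptr : ℕ) (tag : ℕ) (prev : ℕ)
  | htClearSecond (f : HelpCtx n H)
  | htClearFirst (f : HelpCtx n H)
  | cuEnd (b : ℕ) (todo : List ℕ)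
  | cuFirst (b : ℕ) (todo : List ℕ) (ce : ℕ) (scan : List (Fin n × Fin (H + 2)))
  | cuSecond (b : ℕ) (todo : List ℕ) (r : Fin n × Fin (H + 2)) (scan : List (Fin n × Fin (H + 2)))
  | cuFree (b : ℕ) (todo : List ℕ)

/-- A global configuration: shared memory, thread-local variables, program points. -/
structure Config (n H : ℕ) where
  globalEra : ℕ
  counterStart : ℕ
  counterEnd : ℕ
  resv : Fin n → Fin (H + 2) → Resv
  state : Fin n → Fin H → Slot
  /-- memory of the application: the cells that hold references to blocks -/
  mem : ℕ → Option ℕ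
  /-- header fields of blocks -/
  allocEra : ℕ → ℕ
  retireEra : ℕ → ℕ
  /-- blocks handed out by the system allocator and not freed since -/
  allocated : Set ℕ
  allocCount : Fin n → ℕ
  retireCount : Fin n → ℕ
  retireList : Fin n → List ℕ
  pc : Fin n → PC n H

section Config

variable {n H : ℕ}

/-- Index of an ordinary reservation. -/
def normal (j : Fin H) : Fin (H + 2) := Fin.castAdd 2 j

/-- Index of the first special reservation. -/
def special1 : Fin (H + 2) := ⟨H, by omega⟩

/-- Index of the second special reservation. -/
def special2 : Fin (H + 2) := ⟨H + 1, by omega⟩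

/-- All `(i, j)` with `0 ≤ i < max_threads`, `0 ≤ j < max_hes`, in lexicographic order. -/
def allSlots (n H : ℕ) : List (Fin n × Fin H) :=
  (List.finRange n).flatMap fun i => (List.finRange H).map fun j => (i, j)

/-- The ordinary reservations of all threads. -/
def normals (n H : ℕ) : List (Fin n × Fin (H + 2)) :=
  (allSlots n H).map fun p => (p.1, normal p.2)

/-- First scan of `cleanup`: ordinary reservations, then the first special ones. -/
def firstScan (n H : ℕ) : List (Fin n × Fin (H + 2)) :=
  normals n H ++ (List.finRange n).map fun i => (i, special1)

/-- Second scan of `cleanup`: the second special reservations, then the ordinary ones. -/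
def secondScan (n H : ℕ) : List (Fin n × Fin (H + 2)) :=
  ((List.finRange n).map fun i => (i, special2)) ++ normals n H

namespace Config

def goto (c : Config n H) (t : Fin n) (p : PC n H) : Config n H :=
  { c with pc := Function.update c.pc t p }

def setResv (c : Config n H) (i : Fin n) (j : Fin (H + 2)) (v : Resv) : Config n H :=
  { c with resv := Function.update c.resv i (Function.update (c.resv i) j v) }

/-- Store to the era component only. -/
def setResvA (c : Config n H) (i : Fin n) (j : Fin (H + 2)) (e : ℕ∞) : Config n H :=
  c.setResv i j { c.resv i j with A := e }

/-- Store to the tag component only. -/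
def setResvB (c : Config n H) (i : Fin n) (j : Fin (H + 2)) (tag : ℕ) : Config n H :=
  c.setResv i j { c.resv i j with B := tag }

def setSlot (c : Config n H) (i : Fin n) (j : Fin H) (v : Slot) : Config n H :=
  { c with state := Function.update c.state i (Function.update (c.state i) j v) }

def setResult (c : Config n H) (i : Fin n) (j : Fin H) (v : Result) : Config n H :=
  c.setSlot i j { c.state i j with result := v }

end Config

/-- `increment_era` visits the next entry, or leaves its loop. -/
def ieNext (f : Caller) : List (Fin n × Fin H) → PC n H
  | [] => .ieAdd f
  | p :: rest => .ieScan f p.1 p.2 rest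

/-- `cleanup` visits the next block of the retire list, or returns (and so does `retire`). -/
def cuNext : List ℕ → PC n H
  | [] => .idle
  | b :: todo => .cuEnd b todo

/-- The second scan goes on, or ends with the decision to free the block. -/
def cuSecondNext (b : ℕ) (todo : List ℕ) : List (Fin n × Fin (H + 2)) → PC n H
  | [] => .cuFree b todo
  | r :: scan => .cuSecond b todo r scan

/-- `clear` resets the next reservation, or returns. -/
def clearNext : List (Fin H) → PC n H
  | [] => .idle
  | j :: rest => .clear j rest

/-- `can_delete` fails at a reservation of the era `e` that lies in the lifespan of the block `b`. -/
def Conflict (c : Config n H) (b : ℕ) (e : ℕ∞) : Prop :=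
  e ≠ ⊤ ∧ (c.allocEra b : ℕ∞) ≤ e ∧ e ≤ (c.retireEra b : ℕ∞)

open Classical in
/-- The next step of the thread `t`, at every program point but `idle` and `alMalloc`, where the
step is not determined by the configuration (see `Step`). -/
noncomputable def next (P : Params) (t : Fin n) (c : Config n H) : Config n H :=
  match c.pc t with
  | .idle => c
  -- get_protected, fast path
  | .gpEnter a => c.goto t (.gpFastRead a P.maxAttempts (c.resv t (normal a.index)).A)
  | .gpFastRead a k prev => c.goto t (.gpFastEra a k prev (c.mem a.ptr))
  | .gpFastEra a k prev _ =>
      if prev = (c.globalEra : ℕ∞) then c.goto t .idle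
      else c.goto t (.gpFastPublish a k c.globalEra)
  | .gpFastPublish a k new =>
      (c.setResvA t (normal a.index) new).goto t
        (if k - 1 = 0 then .gpParent a new else .gpFastRead a (k - 1) new)
  -- get_protected, slow path
  | .gpParent a prev =>
      c.goto t (.gpStart a prev
        (match a.parent with
          | none => ⊤
          | some b => (c.allocEra b : ℕ∞)))
  | .gpStart a prev pe =>
      { c with counterStart := c.counterStart + 1 }.goto t (.gpSetPointer a prev pe)
  | .gpSetPointer a prev pe =>
      (c.setSlot t a.index { c.state t a.index with pointer := a.ptr }).goto t (.gpSetEra a prev pe)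
  | .gpSetEra a prev pe =>
      (c.setSlot t a.index { c.state t a.index with era := pe }).goto t (.gpTag a prev)
  | .gpTag a prev => c.goto t (.gpRequest a prev (c.resv t (normal a.index)).B)
  | .gpRequest a prev tag => (c.setResult t a.index ⟨.inv, tag⟩).goto t (.gpRead a prev tag)
  | .gpRead a prev tag => c.goto t (.gpEra a prev tag (c.mem a.ptr))
  | .gpEra a prev tag ret =>
      if prev = (c.globalEra : ℕ∞) then c.goto t (.gpCancel a prev tag ret c.globalEra)
      else c.goto t (.gpUpdate a prev tag c.globalEra)
  | .gpCancel a prev tag ret new =>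
      if (c.state t a.index).result = ⟨.inv, tag⟩ then
        (c.setResult t a.index ⟨.ptr none, ⊤⟩).goto t (.gpCancelTag a tag ret)
      else c.goto t (.gpUpdate a prev tag new)
  | .gpCancelTag a tag ret =>
      (c.setResvB t (normal a.index) (tag + 1)).goto t (.gpCancelEnd a ret)
  | .gpCancelEnd _ _ => { c with counterEnd := c.counterEnd + 1 }.goto t .idle
  | .gpUpdate a prev tag new =>
      (if c.resv t (normal a.index) = ⟨prev, tag⟩ then c.setResv t (normal a.index) ⟨new, tag⟩
        else c).goto t (.gpCheck a new tag)
  | .gpCheck a prev tag =>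
      match (c.state t a.index).result.A with
      | .inv => c.goto t (.gpRead a prev tag)
      | .ptr p => c.goto t (.gpOutEra a tag p)
  | .gpOutEra a tag p => c.goto t (.gpOutSetEra a tag p (c.state t a.index).result.B)
  | .gpOutSetEra a tag p era =>
      (c.setResvA t (normal a.index) era).goto t (.gpOutSetTag a tag p)
  | .gpOutSetTag a tag p =>
      (c.setResvB t (normal a.index) (tag + 1)).goto t (.gpOutEnd a p)
  | .gpOutEnd _ _ => { c with counterEnd := c.counterEnd + 1 }.goto t .idle
  -- clear
  | .clear j rest => (c.setResvA t (normal j) ⊤).goto t (clearNext rest)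
  -- alloc_block
  | .alEnter =>
      { c with allocCount := Function.update c.allocCount t (c.allocCount t + 1) }.goto t
        (if c.allocCount t % P.eraFreq = 0 then .ieEnd .alloc else .alMalloc)
  | .alMalloc => c
  | .alEra b => c.goto t (.alSetEra b c.globalEra)
  | .alSetEra b e => { c with allocEra := Function.update c.allocEra b e }.goto t .idle
  -- retire
  | .rtEnter b => c.goto t (.rtSetEra b c.globalEra)
  | .rtSetEra b e =>
      { c with retireEra := Function.update c.retireEra b e }.goto t (.rtAppend b e)
  | .rtAppend b e =>
      { c with
        retireList := Function.update c.retireList t (c.retireList t ++ [b])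
        retireCount := Function.update c.retireCount t (c.retireCount t + 1) }.goto t
        (if c.retireCount t % P.cleanupFreq = 0 then .rtCheck e else .idle)
  | .rtCheck e =>
      if e = c.globalEra then c.goto t (.ieEnd .retire) else c.goto t (cuNext (c.retireList t))
  -- increment_era
  | .ieEnd f => c.goto t (.ieStart f c.counterEnd)
  | .ieStart f ce =>
      if c.counterStart = ce then c.goto t (.ieAdd f) else c.goto t (ieNext f (allSlots n H))
  | .ieScan f i j rest =>
      if (c.state i j).result.A = .inv then c.goto t (.htResult ⟨f, i, j, rest⟩)
      else c.goto t (ieNext f rest)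
  | .ieAdd f =>
      { c with globalEra := c.globalEra + 1 }.goto t
        (match f with
          | .alloc => .alMalloc
          | .retire => cuNext (c.retireList t))
  -- help_thread
  | .htResult f =>
      if (c.state f.i f.j).result.A = .inv then
        c.goto t (.htParentEra f (c.state f.i f.j).result)
      else c.goto t (ieNext f.caller f.rest)
  | .htParentEra f last => c.goto t (.htParentPublish f last (c.state f.i f.j).era)
  | .htParentPublish f last pe => (c.setResvA t special1 pe).goto t (.htPointer f last)
  | .htPointer f last => c.goto t (.htTag f last (c.state f.i f.j).pointer)
  | .htTag f last ptr =>
      if ((c.resv f.i (normal f.j)).B : ℕ∞) = last.B then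
        c.goto t (.htEra f last ptr (c.resv f.i (normal f.j)).B)
      else c.goto t (.htClearFirst f)
  | .htEra f last ptr tag => c.goto t (.htPublish f last ptr tag c.globalEra)
  | .htPublish f last ptr tag prev =>
      (c.setResvA t special2 prev).goto t (.htRead f last ptr tag prev)
  | .htRead f last ptr tag prev => c.goto t (.htReread f last ptr tag prev (c.mem ptr))
  | .htReread f last ptr tag prev ret =>
      if c.globalEra = prev then c.goto t (.htOutput f last tag ret prev)
      else c.goto t (.htLoop f last ptr tag c.globalEra)
  | .htOutput f last tag ret era =>
      if (c.state f.i f.j).result = last then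
        (c.setResult f.i f.j ⟨.ptr ret, era⟩).goto t (.htHandLoad f tag era)
      else c.goto t (.htClearSecond f)
  | .htHandLoad f tag era =>
      if (c.resv f.i (normal f.j)).B = tag then
        c.goto t (.htHandSwap f tag era (c.resv f.i (normal f.j)))
      else c.goto t (.htClearSecond f)
  | .htHandSwap f tag era old =>
      if c.resv f.i (normal f.j) = old then
        (c.setResv f.i (normal f.j) ⟨era, tag + 1⟩).goto t (.htClearSecond f)
      else c.goto t (.htHandLoad f tag era)
  | .htLoop f last ptr tag prev =>
      if (c.state f.i f.j).result = last then c.goto t (.htPublish f last ptr tag prev)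
      else c.goto t (.htClearSecond f)
  | .htClearSecond f => (c.setResvA t special2 ⊤).goto t (.htClearFirst f)
  | .htClearFirst f => (c.setResvA t special1 ⊤).goto t (ieNext f.caller f.rest)
  -- cleanup
  | .cuEnd b todo => c.goto t (.cuFirst b todo c.counterEnd (firstScan n H))
  | .cuFirst b todo ce (r :: scan) =>
      if Conflict c b (c.resv r.1 r.2).A then c.goto t (cuNext todo)
      else c.goto t (.cuFirst b todo ce scan)
  | .cuFirst b todo ce [] =>
      if ce = c.counterStart then c.goto t (.cuFree b todo)
      else c.goto t (cuSecondNext b todo (secondScan n H))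
  | .cuSecond b todo r scan =>
      if Conflict c b (c.resv r.1 r.2).A then c.goto t (cuNext todo)
      else c.goto t (cuSecondNext b todo scan)
  | .cuFree b todo =>
      { c with
        allocated := c.allocated \ {b}
        retireList := Function.update c.retireList t ((c.retireList t).erase b) }.goto t
        (cuNext todo)

/-- Calls of the reclamation interface. -/
inductive Call (H : ℕ) where
  | getProtected (a : GPArgs H)
  | clear
  | allocBlock
  | retire (b : ℕ)

/-- Program point at which a call starts. -/
def Call.entry : Call H → PC n H
  | .getProtected a => .gpEnter a
  | .clear => clearNext (List.finRange H)
  | .allocBlock => .alEnter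
  | .retire b => .rtEnter b

/-- One step of the thread `t`. Between its calls a thread runs arbitrary application code: it may
call any operation with any arguments and may write any reference into any application cell. -/
inductive Step (P : Params) (t : Fin n) : Config n H → Config n H → Prop where
  | call (c : Config n H) (op : Call H) (hidle : c.pc t = .idle) :
      Step P t c (c.goto t op.entry)
  | app (c : Config n H) (x : ℕ) (v : Option ℕ) (hidle : c.pc t = .idle) :
      Step P t c { c with mem := Function.update c.mem x v }
  | malloc (c : Config n H) (b : ℕ) (hpc : c.pc t = .alMalloc) (hb : b ∉ c.allocated) :
      Step P t c ({ c with allocated := insert b c.allocated }.goto t (.alEra b))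
  | run (c : Config n H) (hidle : c.pc t ≠ .idle) (hmalloc : c.pc t ≠ .alMalloc) :
      Step P t c (next P t c)

/-- Initial configurations; the contents of application memory and of block headers are arbitrary. -/
structure Config.IsInitial (c : Config n H) : Prop where
  globalEra : c.globalEra = 1
  counterStart : c.counterStart = 0
  counterEnd : c.counterEnd = 0
  resv : ∀ i j, c.resv i j = ⟨⊤, 0⟩
  result : ∀ i j, (c.state i j).result = ⟨.ptr none, ⊤⟩
  allocated : c.allocated = ∅
  allocCount : ∀ t, c.allocCount t = 0
  retireCount : ∀ t, c.retireCount t = 0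
  retireList : ∀ t, c.retireList t = []
  pc : ∀ t, c.pc t = .idle

/-- `c 0, …, c N` is a finite execution in which the thread `s k` takes the `k`-th step. The
schedule `s` is arbitrary: threads may be delayed or stopped forever. -/
def IsExecution (P : Params) (N : ℕ) (c : ℕ → Config n H) (s : ℕ → Fin n) : Prop :=
  (c 0).IsInitial ∧ ∀ k < N, Step P (s k) (c k) (c (k + 1))

/-- Number of steps that the thread `t` takes from time `k` up to time `m`. -/
def stepCount (s : ℕ → Fin n) (t : Fin n) (k m : ℕ) : ℕ :=
  ((Finset.Ico k m).filter fun l => s l = t).card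

end Config

end WFE

/-!
`retire` is wait-free bounded because a natural number attached to each configuration, the
`retireRank` of the calling thread, decreases with every step of that thread and never increases
with a step of another thread (`Step.retireRank_lt`, `Step.retireRank_le`). At the start of a call it
is an affine function of the length of the retire list, with coefficients that depend on `n` and `H`
only. Away from `help_thread` the rank counts the steps of straight-line code and of loops over
finite lists. The two unbounded loops of `help_thread` are where other threads can interfere.

The main loop runs again only if the era has changed while the slot `(i, j)` still holds the
request `last`. Each thread increments the era at most once meanwhile (`Step.weight_add_globalEra_le`).
Indeed, while the request is pending its owner is on the slow path, so
`counterEnd < counterStart`, and an `increment_era` that reads the counters during this time scans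
all the slots, meets the request, and cannot leave `help_thread` as long as the request is there.
Hence only a scan that had already passed the slot `(i, j)` leads to an increment, and `rounds`, which
counts such scans, bounds the number of further failures.

The loop that hands over the reservation fails only if the reservation has changed while its tag has
not. The request has been answered by then, and its owner writes the reservation at most twice before
it advances the tag; `writesLeft` counts these writes (`Step.writesLeft_cases`).

Both arguments rest on the invariant `Inv`. A pending request carries the current tag of the
reservation, the tags never decrease, and a new request has a tag that no earlier request of the slot
had; so a slot never returns to an earlier request (`Step.result_eq`), and a helper with an outdated
request leaves its loop for good.
-/

namespace WFE

section

variable {n H : ℕ}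

/-! ### Projections of updated configurations -/

namespace Config

variable (c : Config n H) (t : Fin n) (p : PC n H)

@[simp] theorem goto_globalEra : (c.goto t p).globalEra = c.globalEra := rfl
@[simp] theorem goto_counterStart : (c.goto t p).counterStart = c.counterStart := rfl
@[simp] theorem goto_counterEnd : (c.goto t p).counterEnd = c.counterEnd := rfl
@[simp] theorem goto_resv : (c.goto t p).resv = c.resv := rfl
@[simp] theorem goto_state : (c.goto t p).state = c.state := rfl
@[simp] theorem goto_retireList : (c.goto t p).retireList = c.retireList := rfl

@[simp] theorem goto_pc (u : Fin n) : (c.goto t p).pc u = if u = t then p else c.pc u := by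
  simp [goto, Function.update_apply]

variable (i i' : Fin n) (j j' : Fin (H + 2)) (v : Resv) (e : ℕ∞) (tag : ℕ)

@[simp] theorem setResv_globalEra : (c.setResv i j v).globalEra = c.globalEra := rfl
@[simp] theorem setResv_counterStart : (c.setResv i j v).counterStart = c.counterStart := rfl
@[simp] theorem setResv_counterEnd : (c.setResv i j v).counterEnd = c.counterEnd := rfl
@[simp] theorem setResv_state : (c.setResv i j v).state = c.state := rfl
@[simp] theorem setResv_retireList : (c.setResv i j v).retireList = c.retireList := rfl
@[simp] theorem setResv_pc : (c.setResv i j v).pc = c.pc := rfl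

@[simp] theorem setResv_resv : (c.setResv i j v).resv i' j' =
    if i' = i ∧ j' = j then v else c.resv i' j' := by
  by_cases h : i' = i
  · subst h; simp [setResv, Function.update_apply]
  · simp [setResv, h]

@[simp] theorem setResvA_eq : c.setResvA i j e = c.setResv i j ⟨e, (c.resv i j).B⟩ := rfl
@[simp] theorem setResvB_eq : c.setResvB i j tag = c.setResv i j ⟨(c.resv i j).A, tag⟩ := rfl

variable (k k' : Fin H) (w : Slot) (r : Result)

@[simp] theorem setSlot_globalEra : (c.setSlot i k w).globalEra = c.globalEra := rfl
@[simp] theorem setSlot_counterStart : (c.setSlot i k w).counterStart = c.counterStart := rfl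
@[simp] theorem setSlot_counterEnd : (c.setSlot i k w).counterEnd = c.counterEnd := rfl
@[simp] theorem setSlot_resv : (c.setSlot i k w).resv = c.resv := rfl
@[simp] theorem setSlot_retireList : (c.setSlot i k w).retireList = c.retireList := rfl
@[simp] theorem setSlot_pc : (c.setSlot i k w).pc = c.pc := rfl

@[simp] theorem setSlot_state : (c.setSlot i k w).state i' k' =
    if i' = i ∧ k' = k then w else c.state i' k' := by
  by_cases h : i' = i
  · subst h; simp [setSlot, Function.update_apply]
  · simp [setSlot, h]

@[simp] theorem setResult_eq : c.setResult i k r = c.setSlot i k { c.state i k with result := r } :=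
  rfl

end Config

/-! ### The invariant -/

/-- The owner has published the request with tag `τ` for its reservation `j` and has not yet
noticed an answer to it. -/
def Posted : PC n H → Fin H → ℕ → Prop
  | .gpRead a _ tag, j, τ => a.index = j ∧ tag = τ
  | .gpEra a _ tag _, j, τ => a.index = j ∧ tag = τ
  | .gpCancel a _ tag _ _, j, τ => a.index = j ∧ tag = τ
  | .gpUpdate a _ tag _, j, τ => a.index = j ∧ tag = τ
  | .gpCheck a _ tag, j, τ => a.index = j ∧ tag = τ
  | _, _, _ => False

/-- The owner works on the request with tag `τ` for its reservation `j`, has not withdrawn it, and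
has not yet advanced the tag of the reservation. -/
def Late : PC n H → Fin H → ℕ → Prop
  | .gpOutEra a tag _, j, τ => a.index = j ∧ tag = τ
  | .gpOutSetEra a tag _ _, j, τ => a.index = j ∧ tag = τ
  | .gpOutSetTag a tag _, j, τ => a.index = j ∧ tag = τ
  | q, j, τ => Posted q j τ

/-- As `Late`, but the owner may have withdrawn the request. -/
def Busy : PC n H → Fin H → ℕ → Prop
  | .gpCancelTag a tag _, j, τ => a.index = j ∧ tag = τ
  | q, j, τ => Late q j τ

/-- A thread at this program point executes `help_thread(i, j)` with `l` as the value of `last`,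
and has not answered the request. -/
def Helping : PC n H → Fin n → Fin H → Result → Prop
  | .htParentEra f last, i, j, l => f.i = i ∧ f.j = j ∧ last = l
  | .htParentPublish f last _, i, j, l => f.i = i ∧ f.j = j ∧ last = l
  | .htPointer f last, i, j, l => f.i = i ∧ f.j = j ∧ last = l
  | .htTag f last _, i, j, l => f.i = i ∧ f.j = j ∧ last = l
  | .htEra f last _ _, i, j, l => f.i = i ∧ f.j = j ∧ last = l
  | .htPublish f last _ _ _, i, j, l => f.i = i ∧ f.j = j ∧ last = l
  | .htRead f last _ _ _, i, j, l => f.i = i ∧ f.j = j ∧ last = l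
  | .htReread f last _ _ _ _, i, j, l => f.i = i ∧ f.j = j ∧ last = l
  | .htOutput f last _ _ _, i, j, l => f.i = i ∧ f.j = j ∧ last = l
  | .htLoop f last _ _ _, i, j, l => f.i = i ∧ f.j = j ∧ last = l
  | _, _, _, _ => False

/-- The local variables `last` and `tag` of `help_thread`, once both have been read. -/
def HelpTag : PC n H → Result → ℕ → Prop
  | .htEra _ last _ tag, l, τ => last = l ∧ tag = τ
  | .htPublish _ last _ tag _, l, τ => last = l ∧ tag = τ
  | .htRead _ last _ tag _, l, τ => last = l ∧ tag = τ
  | .htReread _ last _ tag _ _, l, τ => last = l ∧ tag = τ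
  | .htOutput _ last tag _ _, l, τ => last = l ∧ tag = τ
  | .htLoop _ last _ tag _, l, τ => last = l ∧ tag = τ
  | _, _, _ => False

/-- A thread at this program point has answered the request with tag `τ` of the slot `(i, j)` and
is handing over its reservation. -/
def Handing : PC n H → Fin n → Fin H → ℕ → Prop
  | .htHandLoad f tag _, i, j, τ => f.i = i ∧ f.j = j ∧ tag = τ
  | .htHandSwap f tag _ _, i, j, τ => f.i = i ∧ f.j = j ∧ tag = τ
  | _, _, _, _ => False

/-- Contribution of a thread to `counterStart - counterEnd`: `1` on the slow path of
`get_protected`, between the increments of the two counters, and `0` elsewhere. -/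
def slowCount : PC n H → ℕ
  | .gpSetPointer .. => 1
  | .gpSetEra .. => 1
  | .gpTag .. => 1
  | .gpRequest .. => 1
  | .gpRead .. => 1
  | .gpEra .. => 1
  | .gpCancel .. => 1
  | .gpCancelTag .. => 1
  | .gpCancelEnd .. => 1
  | .gpUpdate .. => 1
  | .gpCheck .. => 1
  | .gpOutEra .. => 1
  | .gpOutSetEra .. => 1
  | .gpOutSetTag .. => 1
  | .gpOutEnd .. => 1
  | _ => 0

/-- The tag `τ` belongs to a request of the slot `(i, j)` that is over, or that the owner is still
working on; a new request never has such a tag. -/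
def Used (c : Config n H) (i : Fin n) (j : Fin H) (τ : ℕ) : Prop :=
  τ < (c.resv i (normal j)).B ∨ Busy (c.pc i) j τ

/-- The request of the slot `(i, j)` with tag `τ` has been answered by a helper. -/
def Answered (c : Config n H) (i : Fin n) (j : Fin H) (τ : ℕ) : Prop :=
  τ < (c.resv i (normal j)).B ∨ Late (c.pc i) j τ ∧ (c.state i j).result.A ≠ .inv

/-- The invariant that ties `result`, the tag of the reservation and the program point of the
owner together. -/
structure SlotInv (c : Config n H) (i : Fin n) (j : Fin H) : Prop where
  pending : (c.state i j).result.A = .inv →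
    Posted (c.pc i) j (c.resv i (normal j)).B ∧
      (c.state i j).result.B = ((c.resv i (normal j)).B : ℕ∞)
  request : ∀ a prev tag, c.pc i = .gpRequest a prev tag → a.index = j →
    (c.resv i (normal j)).B = tag
  busy : ∀ τ, Busy (c.pc i) j τ → (c.resv i (normal j)).B ≤ τ + 1

/-- The invariant of a thread that executes `increment_era` or `help_thread`. -/
structure HelpInv (c : Config n H) (u : Fin n) : Prop where
  start : ∀ f ce, c.pc u = .ieStart f ce → ce ≤ c.counterEnd
  last : ∀ i j l, Helping (c.pc u) i j l → l.A = .inv ∧ ∃ τ : ℕ, l.B = τ ∧ Used c i j τ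
  tag : ∀ l τ, HelpTag (c.pc u) l τ → l.B = (τ : ℕ∞)
  hand : ∀ i j τ, Handing (c.pc u) i j τ → Answered c i j τ
  swap : ∀ f tag era old, c.pc u = .htHandSwap f tag era old → old.B = tag

/-- The invariant of reachable configurations. -/
structure Inv (c : Config n H) : Prop where
  count : c.counterStart = c.counterEnd + ∑ u, slowCount (c.pc u)
  slot : ∀ i j, SlotInv c i j
  help : ∀ u, HelpInv c u

theorem normal_inj {i j : Fin H} : normal i = normal j ↔ i = j := by
  simp [normal, Fin.ext_iff]

theorem ieNext_cases (f : Caller) (l : List (Fin n × Fin H)) :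
    ieNext f l = .ieAdd f ∧ l = [] ∨
      ∃ p rest, l = p :: rest ∧ ieNext f l = .ieScan f p.1 p.2 rest := by
  cases l <;> simp [ieNext]

theorem cuNext_cases (l : List ℕ) :
    (cuNext l : PC n H) = .idle ∧ l = [] ∨
      ∃ b todo, l = b :: todo ∧ (cuNext l : PC n H) = .cuEnd b todo := by
  cases l <;> simp [cuNext]

theorem cuSecondNext_cases (b : ℕ) (todo : List ℕ) (l : List (Fin n × Fin (H + 2))) :
    cuSecondNext b todo l = .cuFree b todo ∧ l = [] ∨
      ∃ r scan, l = r :: scan ∧ cuSecondNext b todo l = .cuSecond b todo r scan := by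
  cases l <;> simp [cuSecondNext]

theorem clearNext_cases (l : List (Fin H)) :
    (clearNext l : PC n H) = .idle ∧ l = [] ∨
      ∃ j rest, l = j :: rest ∧ (clearNext l : PC n H) = .clear j rest := by
  cases l <;> simp [clearNext]

/-! ### The effect of a step on the slots of other threads -/

theorem Step.pc_of_ne {P : Params} {t u : Fin n} {c c' : Config n H} (hs : Step P t c c')
    (hu : u ≠ t) : c'.pc u = c.pc u := by
  rcases hs with ⟨op, hidle⟩ | ⟨x, v, hidle⟩ | ⟨b, hpc, hb⟩ | ⟨hidle, hmalloc⟩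
  · simp [hu]
  · rfl
  · simp [hu]
  · unfold next
    split <;> (try split) <;> simp [hu]

/-- A step of a thread other than the owner affects a slot only by answering the request or by
handing over the reservation. -/
theorem Step.slot_of_ne {P : Params} {t i : Fin n} {c c' : Config n H} (hs : Step P t c c')
    (hi : i ≠ t) (j : Fin H) :
    (c'.resv i (normal j) = c.resv i (normal j) ∧ (c'.state i j).result = (c.state i j).result) ∨
    (∃ f last tag ret era, c.pc t = .htOutput f last tag ret era ∧ f.i = i ∧ f.j = j ∧
      (c.state i j).result = last ∧ (c'.state i j).result = ⟨.ptr ret, (era : ℕ∞)⟩ ∧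
      c'.resv i (normal j) = c.resv i (normal j)) ∨
    (∃ f tag era old, c.pc t = .htHandSwap f tag era old ∧ f.i = i ∧ f.j = j ∧
      c.resv i (normal j) = old ∧ c'.resv i (normal j) = ⟨(era : ℕ∞), tag + 1⟩ ∧
      (c'.state i j).result = (c.state i j).result) := by
  rcases hs with ⟨op, hidle⟩ | ⟨x, v, hidle⟩ | ⟨b, hpc, hb⟩ | ⟨hidle, hmalloc⟩
  · simp
  · simp
  · simp
  · cases hpc : c.pc t
    case htOutput f last tag ret era =>
      by_cases h : (c.state f.i f.j).result = last
      · by_cases hij : i = f.i ∧ j = f.j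
        · obtain ⟨rfl, rfl⟩ := hij
          exact .inr (.inl ⟨f, last, tag, ret, era, rfl, rfl, rfl, h, by simp [next, hpc, h]⟩)
        · left; simp [next, hpc, h, hij]
      · left; simp [next, hpc, h]
    case htHandSwap f tag era old =>
      by_cases h : c.resv f.i (normal f.j) = old
      · by_cases hij : i = f.i ∧ j = f.j
        · obtain ⟨rfl, rfl⟩ := hij
          exact .inr (.inr ⟨f, tag, era, old, rfl, rfl, rfl, h, by simp [next, hpc, h]⟩)
        · left; simp [next, hpc, h, normal_inj, hij]
      · left; simp [next, hpc, h]
    case cuFirst b todo ce scan =>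
      left
      cases scan <;> simp only [next, hpc] <;> split <;> simp
    all_goals
      left
      simp only [next, hpc]
      (repeat' split) <;> simp [hi]

/-! ### Preservation of the invariant -/

@[simp] theorem not_busy_ieNext (f : Caller) (l : List (Fin n × Fin H)) (j : Fin H) (τ : ℕ) :
    ¬ Busy (ieNext f l) j τ := by
  cases l <;> simp [ieNext, Busy, Late, Posted]

@[simp] theorem not_busy_cuNext (l : List ℕ) (j : Fin H) (τ : ℕ) :
    ¬ Busy (cuNext l : PC n H) j τ := by
  cases l <;> simp [cuNext, Busy, Late, Posted]

@[simp] theorem not_busy_cuSecondNext (b : ℕ) (todo : List ℕ)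
    (l : List (Fin n × Fin (H + 2))) (j : Fin H) (τ : ℕ) :
    ¬ Busy (cuSecondNext b todo l) j τ := by
  cases l <;> simp [cuSecondNext, Busy, Late, Posted]

@[simp] theorem not_busy_clearNext (l : List (Fin H)) (j : Fin H) (τ : ℕ) :
    ¬ Busy (clearNext l : PC n H) j τ := by
  cases l <;> simp [clearNext, Busy, Late, Posted]

@[simp] theorem not_busy_entry (op : Call H) (j : Fin H) (τ : ℕ) :
    ¬ Busy (op.entry : PC n H) j τ := by
  cases op <;> simp [Call.entry] <;> simp [Busy, Late, Posted]

theorem Posted.late {q : PC n H} {j : Fin H} {τ : ℕ} (h : Posted q j τ) : Late q j τ := by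
  cases q <;> simp_all [Posted, Late]

theorem Late.busy {q : PC n H} {j : Fin H} {τ : ℕ} (h : Late q j τ) : Busy q j τ := by
  cases q <;> simp_all [Posted, Late, Busy]

theorem Used.step {P : Params} {t : Fin n} {c c' : Config n H} (hc : Inv c) (hs : Step P t c c')
    {i : Fin n} {j : Fin H} {τ : ℕ} (h : Used c i j τ) : Used c' i j τ := by
  by_cases hi : i = t
  · subst hi
    have hb := (hc.slot i j).busy
    have hh := (hc.help i).swap
    unfold Used at *
    rcases hs with ⟨op, hidle⟩ | ⟨x, v, hidle⟩ | ⟨b, hpc, hb⟩ | ⟨hidle, hmalloc⟩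
    · simp_all [Busy, Late, Posted]
    · simp_all
    · simp_all [Busy, Late, Posted]
    · cases hpc : c.pc i
      case cuFirst b todo ce scan =>
        cases scan <;> simp only [next, hpc] <;> split <;> simp_all [Busy, Late, Posted]
      all_goals
        simp only [next, hpc]
        (repeat' split) <;> simp_all [Busy, Late, Posted] <;> grind [normal_inj]
  · unfold Used at *
    rw [hs.pc_of_ne hi]
    rcases hs.slot_of_ne hi j with ⟨h1, h2⟩ | ⟨f, l, tag, ret, era, h1, rfl, rfl, h2, h3, h4⟩ |
      ⟨f, tag, era, old, h1, rfl, rfl, h2, h3, h4⟩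
    · rwa [h1]
    · rwa [h4]
    · have := (hc.help t).swap _ _ _ _ h1
      rw [h3]
      grind

theorem Answered.step {P : Params} {t : Fin n} {c c' : Config n H} (hc : Inv c)
    (hs : Step P t c c') {i : Fin n} {j : Fin H} {τ : ℕ} (h : Answered c i j τ) :
    Answered c' i j τ := by
  by_cases hi : i = t
  · subst hi
    have hb := (hc.slot i j).busy
    have hh := (hc.help i).swap
    unfold Answered at *
    rcases hs with ⟨op, hidle⟩ | ⟨x, v, hidle⟩ | ⟨b, hpc, hb⟩ | ⟨hidle, hmalloc⟩
    · simp_all [Late, Posted]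
    · simp_all
    · simp_all [Late, Posted]
    · cases hpc : c.pc i
      case cuFirst b todo ce scan =>
        cases scan <;> simp only [next, hpc] <;> split <;> simp_all [Late, Posted]
      all_goals
        simp only [next, hpc]
        (repeat' split) <;> simp_all [Busy, Late, Posted] <;> grind [normal_inj]
  · unfold Answered at *
    rw [hs.pc_of_ne hi]
    rcases hs.slot_of_ne hi j with ⟨h1, h2⟩ | ⟨f, l, tag, ret, era, h1, rfl, rfl, h2, h3, h4⟩ |
      ⟨f, tag, era, old, h1, rfl, rfl, h2, h3, h4⟩
    · rwa [h1, h2]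
    · rw [h4, h3]; grind
    · have := (hc.help t).swap _ _ _ _ h1
      rw [h3, h4]
      grind

theorem Busy.unique {q : PC n H} {j : Fin H} {τ τ' : ℕ} (h : Busy q j τ) (h' : Busy q j τ') :
    τ = τ' := by
  cases q <;> simp only [Busy, Late, Posted] at h h' <;> omega

@[simp] theorem ieNext_ne_gpRequest (f : Caller) (l : List (Fin n × Fin H)) (a : GPArgs H)
    (prev : ℕ∞) (tag : ℕ) : ieNext f l ≠ .gpRequest a prev tag := by
  cases l <;> simp [ieNext]

@[simp] theorem cuNext_ne_gpRequest (l : List ℕ) (a : GPArgs H) (prev : ℕ∞) (tag : ℕ) :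
    (cuNext l : PC n H) ≠ .gpRequest a prev tag := by
  cases l <;> simp [cuNext]

@[simp] theorem cuSecondNext_ne_gpRequest (b : ℕ) (todo : List ℕ)
    (l : List (Fin n × Fin (H + 2))) (a : GPArgs H) (prev : ℕ∞) (tag : ℕ) :
    cuSecondNext b todo l ≠ .gpRequest a prev tag := by
  cases l <;> simp [cuSecondNext]

@[simp] theorem clearNext_ne_gpRequest (l : List (Fin H)) (a : GPArgs H) (prev : ℕ∞) (tag : ℕ) :
    (clearNext l : PC n H) ≠ .gpRequest a prev tag := by
  cases l <;> simp [clearNext]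

@[simp] theorem entry_ne_gpRequest (op : Call H) (a : GPArgs H) (prev : ℕ∞) (tag : ℕ) :
    (op.entry : PC n H) ≠ .gpRequest a prev tag := by
  cases op <;> simp [Call.entry]

theorem SlotInv.of_not_busy {c : Config n H} {i : Fin n} {j : Fin H}
    (hres : (c.state i j).result.A ≠ .inv) (hb : ∀ τ, ¬ Busy (c.pc i) j τ)
    (hr : ∀ a prev tag, c.pc i ≠ .gpRequest a prev tag) : SlotInv c i j :=
  ⟨fun h => (hres h).elim, fun a prev tag h => (hr a prev tag h).elim,
    fun τ h => (hb τ h).elim⟩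

theorem SlotInv.step {P : Params} {t : Fin n} {c c' : Config n H} (hc : Inv c)
    (hs : Step P t c c') (i : Fin n) (j : Fin H) : SlotInv c' i j := by
  obtain ⟨hp, hr, hb⟩ := hc.slot i j
  by_cases hi : i = t
  · subst hi
    -- An owner that is not busy has no pending request.
    have hq : (∀ τ, ¬ Busy (c.pc i) j τ) → (c.state i j).result.A ≠ .inv :=
      fun h h' => h _ (hp h').1.late.busy
    rcases hs with ⟨op, hidle⟩ | ⟨x, v, hidle⟩ | ⟨b, hpc, hb⟩ | ⟨hidle, hmalloc⟩
    · have h0 := hq (by simp [hidle, Busy, Late, Posted])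
      refine .of_not_busy ?_ ?_ ?_ <;> simp [h0]
    · refine .of_not_busy ?_ ?_ ?_ <;> simp_all [Busy, Late, Posted]
    · refine .of_not_busy ?_ ?_ ?_ <;> simp_all [Busy, Late, Posted]
    · cases hpc : c.pc i
      case cuFirst b todo ce scan =>
        have h0 := hq (by simp [hpc, Busy, Late, Posted])
        refine .of_not_busy ?_ ?_ ?_ <;> cases scan <;> simp only [next, hpc] <;> split <;>
          simp [h0] <;> simp [Busy, Late, Posted]
      case gpTag | gpRequest | gpRead | gpEra | gpCancel | gpUpdate | gpCheck | gpOutEra |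
          gpOutSetEra | gpOutSetTag | gpCancelTag =>
        clear hq
        simp only [hpc, Busy, Late, Posted, and_imp, forall_apply_eq_imp_iff] at hp hr hb
        simp only [next, hpc]
        (repeat' split) <;> constructor <;> simp [Busy, Late, Posted] <;>
          grind [normal_inj]
      case idle => exact (hidle hpc).elim
      case alMalloc => exact (hmalloc hpc).elim
      all_goals
        have h0 := hq (by simp [hpc, Busy, Late, Posted])
        simp only [next, hpc]
        (repeat' split) <;> refine .of_not_busy ?_ ?_ ?_ <;> simp [h0] <;>
          first | done | simp [Busy, Late, Posted] | grind
  · have hpc := hs.pc_of_ne hi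
    rcases hs.slot_of_ne hi j with ⟨h1, h2⟩ | ⟨f, l, tag, ret, era, h1, rfl, rfl, h2, h3, h4⟩ |
      ⟨f, tag, era, old, h1, rfl, rfl, h2, h3, h4⟩
    · constructor <;> rw [h1] <;> simpa only [hpc, h2]
    · constructor <;> rw [h4] <;> simp [hpc, h3] <;> assumption
    · -- A helper advances the tag: the request has been answered and the owner still works on it.
      have h5 := (hc.help t).swap _ _ _ _ h1
      have h6 := (hc.help t).hand f.i f.j tag (by simp [h1, Handing])
      unfold Answered at h6
      rw [h2, h5] at h6
      obtain ⟨h7, h8⟩ := h6.resolve_left (lt_irrefl _)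
      constructor <;> rw [h3] <;> simp only [hpc, h4]
      · exact fun h => (h8 h).elim
      · intro a prev tg h
        rw [h] at h7
        simp [Late, Posted] at h7
      · intro τ h
        rw [h.unique h7.busy]

/-- `HelpInv` asks nothing of a thread at this program point. -/
def Inactive : PC n H → Prop
  | .ieStart .. => False
  | .htParentEra .. => False
  | .htParentPublish .. => False
  | .htPointer .. => False
  | .htTag .. => False
  | .htEra .. => False
  | .htPublish .. => False
  | .htRead .. => False
  | .htReread .. => False
  | .htOutput .. => False
  | .htLoop .. => False
  | .htHandLoad .. => False
  | .htHandSwap .. => False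
  | _ => True

@[simp] theorem inactive_ieNext (f : Caller) (l : List (Fin n × Fin H)) :
    Inactive (ieNext f l) := by
  cases l <;> trivial

@[simp] theorem inactive_cuNext (l : List ℕ) : Inactive (cuNext l : PC n H) := by
  cases l <;> trivial

@[simp] theorem inactive_cuSecondNext (b : ℕ) (todo : List ℕ)
    (l : List (Fin n × Fin (H + 2))) : Inactive (cuSecondNext b todo l) := by
  cases l <;> trivial

@[simp] theorem inactive_clearNext (l : List (Fin H)) : Inactive (clearNext l : PC n H) := by
  cases l <;> trivial

@[simp] theorem inactive_entry (op : Call H) : Inactive (op.entry : PC n H) := by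
  cases op <;> simp [Call.entry] <;> trivial

theorem HelpInv.of_inactive {c : Config n H} {u : Fin n} (h : Inactive (c.pc u)) :
    HelpInv c u := by
  cases hq : c.pc u <;> rw [hq] at h <;>
    first
    | exact h.elim
    | constructor <;> simp [hq, Helping, HelpTag, Handing]

theorem Step.counterEnd_le {P : Params} {t : Fin n} {c c' : Config n H} (hs : Step P t c c') :
    c.counterEnd ≤ c'.counterEnd := by
  rcases hs with ⟨op, hidle⟩ | ⟨x, v, hidle⟩ | ⟨b, hpc, hb⟩ | ⟨hidle, hmalloc⟩
  · simp
  · simp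
  · simp
  · cases hpc : c.pc t
    case cuFirst b todo ce scan =>
      cases scan <;> simp only [next, hpc] <;> split <;> simp
    all_goals
      simp only [next, hpc]
      (repeat' split) <;> simp

theorem HelpInv.step {P : Params} {t : Fin n} {c c' : Config n H} (hc : Inv c)
    (hs : Step P t c c') (u : Fin n) : HelpInv c' u := by
  obtain ⟨h1, h2, h3, h4, h5⟩ := hc.help u
  replace h1 : ∀ f ce, c.pc u = .ieStart f ce → ce ≤ c'.counterEnd :=
    fun f ce h => (h1 f ce h).trans hs.counterEnd_le
  replace h2 : ∀ i j l, Helping (c.pc u) i j l →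
      l.A = .inv ∧ ∃ τ : ℕ, l.B = τ ∧ Used c' i j τ := fun i j l h => by
    obtain ⟨ha, τ, hb, hu⟩ := h2 i j l h
    exact ⟨ha, τ, hb, hu.step hc hs⟩
  replace h4 : ∀ i j τ, Handing (c.pc u) i j τ → Answered c' i j τ :=
    fun i j τ h => (h4 i j τ h).step hc hs
  by_cases hu : u = t
  · subst hu
    have hUsed : ∀ i j τ, Used c i j τ → Used c' i j τ := fun i j τ h => h.step hc hs
    rcases hs with ⟨op, hidle⟩ | ⟨x, v, hidle⟩ | ⟨b, hpc, hb⟩ | ⟨hidle, hmalloc⟩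
    · exact .of_inactive (by simp)
    · exact .of_inactive (by simp [hidle, Inactive])
    · exact .of_inactive (by simp [Inactive])
    · cases hpc : c.pc u
      case idle => exact (hidle hpc).elim
      case alMalloc => exact (hmalloc hpc).elim
      case cuFirst b todo ce scan =>
        refine .of_inactive ?_
        cases scan <;> simp only [next, hpc] <;> split <;> simp <;> simp [Inactive]
      case ieEnd f =>
        constructor <;> simp [next, hpc, Helping, HelpTag, Handing]
      case htResult f =>
        by_cases h : (c.state f.i f.j).result.A = .inv
        · obtain ⟨ha, hb⟩ := (hc.slot f.i f.j).pending h
          have hn : (next P u c).pc u = .htParentEra f (c.state f.i f.j).result := by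
            simp [next, hpc, h]
          constructor <;> simp only [hn, Helping, HelpTag, Handing] <;> try simp
          exact ⟨h, _, hb, hUsed _ _ _ (.inr ha.late.busy)⟩
        · exact .of_inactive (by simp [next, hpc, h])
      case htOutput f last tag ret era =>
        -- A successful answer meets a pending request, so the owner is posted with the same tag.
        by_cases h : (c.state f.i f.j).result = last
        · have hn : next P u c = (c.setResult f.i f.j ⟨.ptr ret, era⟩).goto u
              (.htHandLoad f tag era) := by
            simp [next, hpc, h]
          have hl := (h2 f.i f.j last (by simp [hpc, Helping])).1
          have ht := h3 last tag (by simp [hpc, HelpTag])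
          obtain ⟨ha, hb⟩ := (hc.slot f.i f.j).pending (by rw [h, hl])
          rw [h, ht, Nat.cast_inj] at hb
          have hi : f.i ≠ u := fun e => by simp [e, hpc, Posted] at ha
          rw [hn]
          constructor <;> simp [Helping, HelpTag, Handing]
          exact .inr (by simpa [hi, hb] using ha.late)
        · have hn : (next P u c).pc u = .htClearSecond f := by simp [next, hpc, h]
          exact .of_inactive (by simp [hn, Inactive])
      case htTag | htHandLoad | htHandSwap | htParentEra | htParentPublish | htPointer | htEra |
          htPublish | htRead | htReread | htLoop =>
        simp only [hpc, Helping, HelpTag, Handing, and_imp, forall_eq', forall_apply_eq_imp_iff] at h1 h2 h3 h4 h5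
        generalize hcc : next P u c = c'' at *
        simp only [next, hpc] at hcc
        have hpc' := congrArg (fun c => c.pc u) hcc
        (repeat' split at hpc') <;> simp only [Config.goto_pc, if_true] at hpc' <;>
          constructor <;> rw [← hpc'] <;> simp [Helping, HelpTag, Handing] <;> grind
      all_goals
        refine .of_inactive ?_
        simp only [next, hpc]
        (repeat' split) <;> simp <;> simp [Inactive]
  · constructor <;> rwa [hs.pc_of_ne hu]

/-- A step changes `counterStart - counterEnd` by as much as it changes the number of threads on
the slow path. -/
theorem Step.slowCount_balance {P : Params} {t : Fin n} {c c' : Config n H} (hs : Step P t c c') :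
    c'.counterStart + c.counterEnd + slowCount (c.pc t) =
      c.counterStart + c'.counterEnd + slowCount (c'.pc t) := by
  rcases hs with ⟨op, hidle⟩ | ⟨x, v, hidle⟩ | ⟨b, hpc, hb⟩ | ⟨hidle, hmalloc⟩
  · simp only [hidle, Config.goto_pc, if_true, Config.goto_counterStart, Config.goto_counterEnd]
    cases op <;> simp [Call.entry, slowCount]
    cases List.finRange H <;> simp [clearNext]
  · simp
  · simp [hpc, slowCount]
  · cases hpc : c.pc t
    case idle => exact (hidle hpc).elim
    case alMalloc => exact (hmalloc hpc).elim
    case cuFirst b todo ce scan =>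
      cases scan <;> simp only [next, hpc] <;> split <;> simp [slowCount]
      all_goals grind [cuNext_cases, cuSecondNext_cases, slowCount]
    all_goals
      simp only [next, hpc]
      (repeat' split) <;> simp <;>
        grind [cuNext_cases, cuSecondNext_cases, ieNext_cases, clearNext_cases, slowCount]

theorem Inv.step {P : Params} {t : Fin n} {c c' : Config n H} (hc : Inv c)
    (hs : Step P t c c') : Inv c' := by
  refine ⟨?_, SlotInv.step hc hs, HelpInv.step hc hs⟩
  have h1 := hs.slowCount_balance
  have h2 := hc.count
  rw [← Finset.add_sum_erase _ _ (Finset.mem_univ t)] at h2 ⊢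
  rw [Finset.sum_congr rfl fun u hu => by rw [hs.pc_of_ne (Finset.ne_of_mem_erase hu)]]
  omega

theorem Inv.of_isInitial {c : Config n H} (h : c.IsInitial) : Inv c where
  count := by simp [h.counterStart, h.counterEnd, h.pc, slowCount]
  slot i j := .of_not_busy (by simp [h.result]) (by simp [h.pc, Busy, Late, Posted])
    (by simp [h.pc])
  help u := .of_inactive (by simp [h.pc, Inactive])

/-! ### Era increments during a request -/

/-- The activation record of `help_thread`, at the program points within `help_thread`. -/
def helpCtx : PC n H → Option (HelpCtx n H)
  | .htResult f => some f
  | .htParentEra f _ => some f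
  | .htParentPublish f _ _ => some f
  | .htPointer f _ => some f
  | .htTag f _ _ => some f
  | .htEra f _ _ _ => some f
  | .htPublish f _ _ _ _ => some f
  | .htRead f _ _ _ _ => some f
  | .htReread f _ _ _ _ _ => some f
  | .htOutput f _ _ _ _ => some f
  | .htLoop f _ _ _ _ => some f
  | .htHandLoad f _ _ => some f
  | .htHandSwap f _ _ _ => some f
  | .htClearSecond f => some f
  | .htClearFirst f => some f
  | _ => none

/-- As long as the slot `(i, j)` holds the request `l`, a thread at this program point cannot leave
`help_thread`. -/
def Engaged : PC n H → Fin n → Fin H → Result → Prop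
  | .htResult f, i, j, _ => f.i = i ∧ f.j = j
  | q, i, j, l => Helping q i j l

open Classical in
/-- An upper bound on the number of times that a thread at this program point can increment the era
while the slot `(i, j)` holds the request `l`: it can do so once if its scan has passed the slot
already, and otherwise it gets caught in helping with the request. -/
noncomputable def weight (i : Fin n) (j : Fin H) (l : Result) : PC n H → ℕ
  | .ieAdd _ => 1
  | .ieScan _ i' j' rest => if (i, j) ∈ (i', j') :: rest then 0 else 1
  | q =>
    match helpCtx q with
    | none => 0
    | some f => if (i, j) ∈ f.rest ∨ Engaged q i j l then 0 else 1

open Classical in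
/-- An upper bound on the number of times that the comparison of `prev` with the era can still fail
in the loop of `help_thread(i, j)` that serves the request `l`. -/
noncomputable def rounds (c : Config n H) (i : Fin n) (j : Fin H) (l : Result) (prev : ℕ) : ℕ :=
  if (c.state i j).result = l then
    ∑ u, weight i j l (c.pc u) + if prev = c.globalEra then 0 else 1
  else 0

theorem weight_le_one (i : Fin n) (j : Fin H) (l : Result) (q : PC n H) : weight i j l q ≤ 1 := by
  unfold weight
  (repeat' split) <;> simp

theorem weight_ieNext (i : Fin n) (j : Fin H) (l : Result) (f : Caller)
    (rest : List (Fin n × Fin H)) :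
    weight i j l (ieNext f rest) = if (i, j) ∈ rest then 0 else 1 := by
  classical
  cases rest <;> simp [ieNext, weight]

@[simp] theorem weight_cuNext (i : Fin n) (j : Fin H) (l : Result) (todo : List ℕ) :
    weight i j l (cuNext todo) = 0 := by
  cases todo <;> simp [cuNext, weight, helpCtx]

@[simp] theorem weight_cuSecondNext (i : Fin n) (j : Fin H) (l : Result) (b : ℕ) (todo : List ℕ)
    (scan : List (Fin n × Fin (H + 2))) :
    weight i j l (cuSecondNext b todo scan) = 0 := by
  cases scan <;> simp [cuSecondNext, weight, helpCtx]

@[simp] theorem weight_clearNext (i : Fin n) (j : Fin H) (l : Result) (rest : List (Fin H)) :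
    weight i j l (clearNext rest) = 0 := by
  cases rest <;> simp [clearNext, weight, helpCtx]

@[simp] theorem weight_entry (i : Fin n) (j : Fin H) (l : Result) (op : Call H) :
    weight i j l op.entry = 0 := by
  cases op <;> simp [Call.entry] <;> simp [weight, helpCtx]

theorem mem_allSlots (p : Fin n × Fin H) : p ∈ allSlots n H := by
  obtain ⟨i, j⟩ := p
  simp [allSlots]

theorem Posted.slowCount {q : PC n H} {j : Fin H} {τ : ℕ} (h : Posted q j τ) :
    slowCount q = 1 := by
  cases q <;> simp_all [Posted, WFE.slowCount]

/-- Each increment of the era during a request is paid for by the weight of the thread that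
makes it. -/
theorem Step.weight_add_globalEra_le {P : Params} {t : Fin n} {c c' : Config n H} (hc : Inv c)
    (hs : Step P t c c') {i : Fin n} {j : Fin H} {l : Result} (hl : (c.state i j).result = l)
    (hl' : (c'.state i j).result = l) (hA : l.A = .inv) :
    weight i j l (c'.pc t) + c'.globalEra ≤ weight i j l (c.pc t) + c.globalEra ∧
      c.globalEra ≤ c'.globalEra := by
  classical
  subst hl
  obtain ⟨hp, hB⟩ := (hc.slot i j).pending hA
  -- The owner of a pending request is on the slow path.
  have hcount : c.counterEnd < c.counterStart := by
    have h1 := hc.count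
    have h2 := Finset.single_le_sum (f := fun u => WFE.slowCount (c.pc u))
      (fun _ _ => Nat.zero_le _) (Finset.mem_univ i)
    simp only [hp.slowCount] at h2
    omega
  have hstart := (hc.help t).start
  rcases hs with ⟨op, hidle⟩ | ⟨x, v, hidle⟩ | ⟨b, hpc, hb⟩ | ⟨hidle, hmalloc⟩
  · simp
  · simp
  · simp [weight, helpCtx]
  · cases hpc : c.pc t
    case idle => exact (hidle hpc).elim
    case alMalloc => exact (hmalloc hpc).elim
    case cuFirst b todo ce scan =>
      cases scan <;> simp only [next, hpc] <;> split <;> simp <;> simp [weight, helpCtx]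
    case ieStart f ce =>
      have := hstart f ce hpc
      have h : c.counterStart ≠ ce := by omega
      simp [next, hpc, h, weight_ieNext, mem_allSlots]
    case ieAdd f =>
      cases f <;> simp [next, hpc] <;> simp [weight, helpCtx, add_comm]
    case ieScan f i' j' rest =>
      simp only [next, hpc]
      split <;> simp [weight_ieNext] <;> simp [weight, helpCtx, Engaged] <;> grind
    case htTag f last ptr =>
      -- A pending request has the tag of the reservation, so the helper goes on to the loop.
      simp only [next, hpc]
      split <;> simp <;> simp [weight, helpCtx, Engaged, Helping] <;> grind
    case htClearFirst f =>
      simp [next, hpc, weight_ieNext]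
      simp [weight, helpCtx, Engaged, Helping]
    case htOutput f last tag ret era =>
      -- The attempt fails for the slot `(i, j)`, since success would overwrite the request.
      simp only [next, hpc] at hl' ⊢
      split at hl' <;> rename_i h <;> simp only [h, if_true, if_false] <;> simp at hl' <;>
        simp <;> simp [weight, helpCtx, Engaged, Helping] <;> grind
    case htResult f =>
      simp only [next, hpc]
      split <;> simp [weight_ieNext] <;> simp [weight, helpCtx, Engaged, Helping] <;> grind
    all_goals
      simp only [next, hpc]
      (repeat' split) <;> simp <;> simp [weight, helpCtx, Engaged, Helping] <;> grind

/-- Requests are never repeated: a slot does not return to the request `l` that a helper has read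
from it. -/
theorem Step.result_eq {P : Params} {t : Fin n} {c c' : Config n H} (hs : Step P t c c')
    (hc : Inv c) {i : Fin n} {j : Fin H} {l : Result} (hA : l.A = .inv)
    {τ : ℕ} (hB : l.B = τ) (hu : Used c i j τ) (hl : (c'.state i j).result = l) :
    (c.state i j).result = l := by
  by_cases hi : i = t
  · subst hi
    have hr := (hc.slot i j).request
    rcases hs with ⟨op, hidle⟩ | ⟨x, v, hidle⟩ | ⟨b, hpc, hb⟩ | ⟨hidle, hmalloc⟩
    · simpa using hl
    · simpa using hl
    · simpa using hl
    · cases hpc : c.pc i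
      case cuFirst b todo ce scan =>
        cases scan <;> simp only [next, hpc] at hl <;> split at hl <;> simpa using hl
      case gpRequest a prev tag =>
        by_cases hj : a.index = j
        · -- The new request has the current tag, which no `Used` tag equals before the request.
          subst hj
          have h1 := hr a prev tag hpc rfl
          simp only [next, hpc] at hl
          subst hl
          simp only [Config.setResult_eq, Config.goto_state, Config.setSlot_state, and_self,
            if_true, Nat.cast_inj] at hB
          simp only [Used, hpc, Busy, Late, Posted, or_false] at hu
          omega
        · simpa [next, hpc, Ne.symm hj] using hl
      all_goals
        simp only [next, hpc] at hl
        revert hl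
        (repeat' split) <;> simp <;> grind
  · rcases hs.slot_of_ne hi j with ⟨h1, h2⟩ | ⟨f, l, tag, ret, era, h1, rfl, rfl, h2, h3, h4⟩ |
      ⟨f, tag, era, old, h1, rfl, rfl, h2, h3, h4⟩
    · rw [← h2, hl]
    · rw [← hl, h3] at hA
      cases hA
    · rw [← h4, hl]

theorem Step.rounds_le {P : Params} {t : Fin n} {c c' : Config n H} (hs : Step P t c c')
    (hc : Inv c) {i : Fin n} {j : Fin H} {l : Result} (hA : l.A = .inv)
    {τ : ℕ} (hB : l.B = τ) (hu : Used c i j τ) (prev : ℕ) :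
    rounds c' i j l prev ≤ rounds c i j l prev := by
  unfold rounds
  by_cases h' : (c'.state i j).result = l
  · have h := hs.result_eq hc hA hB hu h'
    obtain ⟨h1, h2⟩ := hs.weight_add_globalEra_le hc h h' hA
    rw [if_pos h, if_pos h', ← Finset.add_sum_erase _ _ (Finset.mem_univ t),
      ← Finset.add_sum_erase (a := t) _ (fun u => weight i j l (c.pc u)) (Finset.mem_univ t),
      Finset.sum_congr rfl fun u hu => by rw [hs.pc_of_ne (Finset.ne_of_mem_erase hu)]]
    split_ifs <;> omega
  · simp [h']

theorem rounds_globalEra_le (c : Config n H) (i : Fin n) (j : Fin H) (l : Result) :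
    rounds c i j l c.globalEra ≤ n := by
  unfold rounds
  split
  · simpa using Finset.sum_le_card_nsmul Finset.univ (fun u => weight i j l (c.pc u)) 1
      fun u _ => weight_le_one i j l (c.pc u)
  · simp

theorem rounds_of_ne {c : Config n H} {i : Fin n} {j : Fin H} {l : Result} {prev : ℕ}
    (hl : (c.state i j).result = l) (hprev : c.globalEra ≠ prev) :
    rounds c i j l prev = rounds c i j l c.globalEra + 1 := by
  simp [rounds, hl, hprev.symm]

/-! ### Handing over the reservation -/

/-- How often the owner of an answered request can still write its reservation before it advances
the tag: at most once in `gpUpdate`, and once to store the era of the output. -/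
def writesLeft : PC n H → ℕ
  | .gpRead .. => 2
  | .gpEra .. => 2
  | .gpCancel .. => 2
  | .gpUpdate .. => 2
  | .gpCheck .. => 1
  | .gpOutEra .. => 1
  | .gpOutSetEra .. => 1
  | _ => 0

theorem writesLeft_le (q : PC n H) : writesLeft q ≤ 2 := by
  unfold writesLeft
  split <;> simp

/-- While the tag of an answered request stands, the reservation changes only at the expense of
`writesLeft`. -/
theorem Step.writesLeft_cases {P : Params} {t : Fin n} {c c' : Config n H} (hs : Step P t c c')
    (hc : Inv c) {i : Fin n} {j : Fin H} {τ : ℕ} (ha : Answered c i j τ) :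
    (c'.resv i (normal j)).B ≠ τ ∨
      (c.resv i (normal j)).B = τ ∧
        (c'.resv i (normal j) = c.resv i (normal j) ∧
            writesLeft (c'.pc i) ≤ writesLeft (c.pc i) ∨
          writesLeft (c'.pc i) < writesLeft (c.pc i)) := by
  by_cases hB : (c'.resv i (normal j)).B = τ
  swap
  · exact .inl hB
  by_cases hi : i = t
  · subst hi
    have hb := (hc.slot i j).busy
    have hw := (hc.help i).swap
    unfold Answered at ha
    rcases hs with ⟨op, hidle⟩ | ⟨x, v, hidle⟩ | ⟨b, hpc, hb⟩ | ⟨hidle, hmalloc⟩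
    · simp_all [Late, Posted]
    · simp_all
    · simp_all [Late, Posted]
    · right
      cases hpc : c.pc i
      case idle => exact (hidle hpc).elim
      case alMalloc => exact (hmalloc hpc).elim
      case cuFirst b todo ce scan =>
        simp only [hpc, Late, Posted] at ha hb
        cases scan <;> simp only [next, hpc] at hB ⊢ <;> split at hB <;> simp at hB <;> grind
      all_goals
        simp only [hpc, Busy, Late, Posted, and_imp, forall_apply_eq_imp_iff]
          at ha hb hw
        simp only [next, hpc] at hB ⊢
        revert hB
        (repeat' split) <;> simp <;> grind [normal_inj, writesLeft]
  · right
    rw [hs.pc_of_ne hi]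
    rcases hs.slot_of_ne hi j with ⟨h1, h2⟩ | ⟨f, l, tag, ret, era, h1, rfl, rfl, h2, h3, h4⟩ |
      ⟨f, tag, era, old, h1, rfl, rfl, h2, h3, h4⟩
    · rw [h1] at hB ⊢
      exact ⟨hB, .inl ⟨rfl, le_rfl⟩⟩
    · rw [h4] at hB ⊢
      exact ⟨hB, .inl ⟨rfl, le_rfl⟩⟩
    · have h5 := (hc.help t).swap _ _ _ _ h1
      rw [h3] at hB
      unfold Answered at ha
      -- The swap advances the tag, so the tag can only be `τ` afterwards if it was smaller before.
      simp only at hB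
      have h6 : τ = (c.resv f.i (normal f.j)).B + 1 := by rw [h2, h5, hB]
      rcases ha with ha | ⟨ha, -⟩
      · omega
      · have h7 := (hc.help t).hand f.i f.j tag (by simp [h1, Handing])
        unfold Answered at h7
        rcases h7 with h7 | ⟨h7, -⟩
        · rw [h2, h5] at h7; omega
        · have := h7.busy.unique ha.busy
          omega

/-! ### The rank -/

/-- Steps that `cleanup` needs at most for one block. -/
def blockCost (n H : ℕ) : ℕ := (firstScan n H).length + (secondScan n H).length + 3

/-- Steps that `increment_era` needs at most for one entry of `state`. -/
def slotCost (n : ℕ) : ℕ := 5 * n + 26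

open Classical in
/-- A bound on the number of own steps after which a thread at this program point leaves
`help_thread`; it is `0` at the program points outside of `help_thread`. A round of the main loop
takes four steps and is worth five. In the hand-over loop, a swap that is bound to fail
(`resv ≠ old`) is worth `2` more than one that may succeed; each write of the owner, which can spoil
one swap, pays for this difference. -/
noncomputable def helpRank (c : Config n H) : PC n H → ℕ
  | .htResult _ => 5 * n + 25
  | .htParentEra .. => 5 * n + 24
  | .htParentPublish .. => 5 * n + 23
  | .htPointer .. => 5 * n + 22
  | .htTag .. => 5 * n + 21
  | .htEra .. => 5 * n + 20
  | .htPublish f last _ _ prev => 5 * rounds c f.i f.j last prev + 14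
  | .htRead f last _ _ prev => 5 * rounds c f.i f.j last prev + 13
  | .htReread f last _ _ prev _ => 5 * rounds c f.i f.j last prev + 12
  | .htLoop f last _ _ prev =>
      if (c.state f.i f.j).result = last then 5 * rounds c f.i f.j last prev + 15 else 11
  | .htOutput .. => 10
  | .htHandLoad f tag _ =>
      if (c.resv f.i (normal f.j)).B = tag then 2 * writesLeft (c.pc f.i) + 5 else 3
  | .htHandSwap f tag _ old =>
      if (c.resv f.i (normal f.j)).B = tag then
        if c.resv f.i (normal f.j) = old then 2 * writesLeft (c.pc f.i) + 4
        else 2 * writesLeft (c.pc f.i) + 6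
      else 4
  | .htClearSecond _ => 2
  | .htClearFirst _ => 1
  | _ => 0

/-- A bound on the number of own steps after which a thread at this program point of `retire`, with
a retire list of length `L`, has returned; outside of `retire` the value has no meaning. -/
noncomputable def retireRank (c : Config n H) (L : ℕ) : PC n H → ℕ
  | .rtEnter _ => blockCost n H * (L + 1) + slotCost n * (allSlots n H).length + 7
  | .rtSetEra .. => blockCost n H * (L + 1) + slotCost n * (allSlots n H).length + 6
  | .rtAppend .. => blockCost n H * (L + 1) + slotCost n * (allSlots n H).length + 5
  | .rtCheck _ => blockCost n H * L + slotCost n * (allSlots n H).length + 4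
  | .ieEnd _ => blockCost n H * L + slotCost n * (allSlots n H).length + 3
  | .ieStart .. => blockCost n H * L + slotCost n * (allSlots n H).length + 2
  | .ieScan _ _ _ rest => blockCost n H * L + slotCost n * (rest.length + 1) + 1
  | .ieAdd _ => blockCost n H * L + 1
  | .cuEnd _ todo => blockCost n H * (todo.length + 1)
  | .cuFirst _ todo _ scan =>
      blockCost n H * todo.length + (secondScan n H).length + scan.length + 2
  | .cuSecond _ todo _ scan => blockCost n H * todo.length + scan.length + 2
  | .cuFree _ todo => blockCost n H * todo.length + 1
  | q =>
    match helpCtx q with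
    | some f => blockCost n H * L + slotCost n * f.rest.length + 1 + helpRank c q
    | none => 0

/-- The program points of a call of `retire`. -/
def InRetire : PC n H → Prop
  | .rtEnter _ => True
  | .rtSetEra .. => True
  | .rtAppend .. => True
  | .rtCheck _ => True
  | .ieEnd f => f = .retire
  | .ieStart f _ => f = .retire
  | .ieScan f _ _ _ => f = .retire
  | .ieAdd f => f = .retire
  | .cuEnd .. => True
  | .cuFirst .. => True
  | .cuSecond .. => True
  | .cuFree .. => True
  | q =>
    match helpCtx q with
    | some f => f.caller = .retire
    | none => False

theorem Step.helpRank_le {P : Params} {t : Fin n} {c c' : Config n H} (hs : Step P t c c')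
    (hc : Inv c) (u : Fin n) : helpRank c' (c.pc u) ≤ helpRank c (c.pc u) := by
  have hround : ∀ (f : HelpCtx n H) l prev, Helping (c.pc u) f.i f.j l →
      rounds c' f.i f.j l prev ≤ rounds c f.i f.j l prev := fun f l prev h => by
    obtain ⟨hA, τ, hB, hu⟩ := (hc.help u).last _ _ _ h
    exact hs.rounds_le hc hA hB hu prev
  have hhand := (hc.help u).hand
  have hlast := (hc.help u).last
  cases hpc : c.pc u
  case htPublish f last ptr tag prev =>
    have := hround f last prev (by simp [hpc, Helping])
    simp only [helpRank]; omega
  case htRead f last ptr tag prev =>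
    have := hround f last prev (by simp [hpc, Helping])
    simp only [helpRank]; omega
  case htReread f last ptr tag prev ret =>
    have := hround f last prev (by simp [hpc, Helping])
    simp only [helpRank]; omega
  case htLoop f last ptr tag prev =>
    have := hround f last prev (by simp [hpc, Helping])
    obtain ⟨hA, τ, hB, hu⟩ := hlast f.i f.j last (by simp [hpc, Helping])
    have := hs.result_eq hc hA hB hu
    simp only [helpRank]
    split_ifs <;> first | omega | grind
  case htHandLoad f tag era =>
    have := hs.writesLeft_cases hc (hhand f.i f.j tag (by simp [hpc, Handing]))
    simp only [helpRank]
    split_ifs <;> grind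
  case htHandSwap f tag era old =>
    have := hs.writesLeft_cases hc (hhand f.i f.j tag (by simp [hpc, Handing]))
    simp only [helpRank]
    split_ifs <;> grind
  all_goals simp [helpRank]

theorem Step.retireList_of_ne {P : Params} {t u : Fin n} {c c' : Config n H} (hs : Step P t c c')
    (hu : u ≠ t) : c'.retireList u = c.retireList u := by
  rcases hs with ⟨op, hidle⟩ | ⟨x, v, hidle⟩ | ⟨b, hpc, hb⟩ | ⟨hidle, hmalloc⟩
  · simp
  · rfl
  · simp
  · unfold next
    split <;> (try split) <;> simp [hu]

theorem retireRank_mono {c c' : Config n H} {q : PC n H} (h : helpRank c' q ≤ helpRank c q)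
    (L : ℕ) : retireRank c' L q ≤ retireRank c L q := by
  cases q <;> simp only [retireRank, helpCtx, le_refl] <;> omega

theorem Step.retireRank_le {P : Params} {t u : Fin n} {c c' : Config n H} (hs : Step P t c c')
    (hc : Inv c) (hu : u ≠ t) :
    retireRank c' (c'.retireList u).length (c'.pc u) ≤
      retireRank c (c.retireList u).length (c.pc u) := by
  rw [hs.retireList_of_ne hu, hs.pc_of_ne hu]
  exact retireRank_mono (hs.helpRank_le hc u) _

@[simp] theorem retireRank_cuNext (c : Config n H) (L : ℕ) (todo : List ℕ) :
    retireRank c L (cuNext todo) = blockCost n H * todo.length := by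
  cases todo <;> simp [cuNext, retireRank, helpCtx]

@[simp] theorem retireRank_cuSecondNext (c : Config n H) (L b : ℕ) (todo : List ℕ)
    (scan : List (Fin n × Fin (H + 2))) :
    retireRank c L (cuSecondNext b todo scan) = blockCost n H * todo.length + scan.length + 1 := by
  cases scan <;> simp [cuSecondNext, retireRank]; omega

@[simp] theorem retireRank_ieNext (c : Config n H) (L : ℕ) (f : Caller)
    (rest : List (Fin n × Fin H)) :
    retireRank c L (ieNext f rest) = blockCost n H * L + slotCost n * rest.length + 1 := by
  cases rest <;> simp [ieNext, retireRank]

@[simp] theorem inRetire_cuNext (todo : List ℕ) :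
    (cuNext todo : PC n H) = .idle ∨ InRetire (cuNext todo : PC n H) := by
  cases todo <;> simp [cuNext, InRetire]

@[simp] theorem inRetire_cuSecondNext (b : ℕ) (todo : List ℕ)
    (scan : List (Fin n × Fin (H + 2))) : InRetire (cuSecondNext b todo scan) := by
  cases scan <;> simp [cuSecondNext, InRetire]

@[simp] theorem inRetire_ieNext (rest : List (Fin n × Fin H)) :
    InRetire (ieNext .retire rest) := by
  cases rest <;> simp [ieNext, InRetire]

theorem InRetire.ne_idle {q : PC n H} (h : InRetire q) : q ≠ .idle := by
  rintro rfl; simp [InRetire, helpCtx] at h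

theorem InRetire.ne_alMalloc {q : PC n H} (h : InRetire q) : q ≠ .alMalloc := by
  rintro rfl; simp [InRetire, helpCtx] at h

theorem Step.eq_next {P : Params} {t : Fin n} {c c' : Config n H} (hs : Step P t c c')
    (hr : InRetire (c.pc t)) : c' = next P t c := by
  rcases hs with ⟨op, hidle⟩ | ⟨x, v, hidle⟩ | ⟨b, hpc, hb⟩ | ⟨hidle, hmalloc⟩
  · exact (hr.ne_idle hidle).elim
  · exact (hr.ne_idle hidle).elim
  · exact (hr.ne_alMalloc hpc).elim
  · rfl

theorem Step.inRetire {P : Params} {t : Fin n} {c c' : Config n H} (hs : Step P t c c')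
    (hr : InRetire (c.pc t)) : c'.pc t = .idle ∨ InRetire (c'.pc t) := by
  obtain rfl := hs.eq_next hr
  cases hpc : c.pc t <;> simp only [hpc, InRetire, helpCtx] at hr
  case cuFirst b todo ce scan =>
    cases scan <;> simp only [next, hpc] <;> split <;> simp <;> simp [InRetire]
  all_goals
    try cases hr
    simp only [next, hpc]
    (repeat' split) <;> simp [*] <;> simp [InRetire, helpCtx, *]

/-- Each step of `help_thread` leads to its end or decreases `helpRank`. -/
theorem Step.helpRank_lt {P : Params} {t : Fin n} {c c' : Config n H} (hs : Step P t c c')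
    (hc : Inv c) {f : HelpCtx n H} (hf : helpCtx (c.pc t) = some f) :
    0 < helpRank c (c.pc t) ∧ c'.retireList t = c.retireList t ∧
      (c'.pc t = ieNext f.caller f.rest ∨
        helpCtx (c'.pc t) = some f ∧ helpRank c' (c'.pc t) < helpRank c (c.pc t)) := by
  have hmono := hs.helpRank_le hc t
  have hc' : c' = next P t c := by
    rcases hs with ⟨op, hidle⟩ | ⟨x, v, hidle⟩ | ⟨b, hpc, hb⟩ | ⟨hidle, hmalloc⟩
    · simp [hidle, helpCtx] at hf
    · simp [hidle, helpCtx] at hf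
    · simp [hpc, helpCtx] at hf
    · rfl
  cases hpc : c.pc t <;> simp only [hpc, helpCtx, reduceCtorEq, Option.some.injEq] at hf <;>
    subst hf <;> rw [hpc] at hmono <;> simp only [next, hpc] at hc'
  case htEra f last ptr tag =>
    have := rounds_globalEra_le c' f.i f.j last
    subst hc'
    simp [helpCtx] at this ⊢
    simp [helpRank]
    omega
  case htReread f last ptr tag prev ret =>
    split at hc'
    · subst hc'
      simp [helpCtx]
      simp [helpRank]
    · rename_i h
      refine ⟨by simp [helpRank], by simp [hc'], .inr ⟨by simp [hc', helpCtx], ?_⟩⟩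
      refine lt_of_lt_of_le ?_ hmono
      have hera : c'.globalEra = c.globalEra := by simp [hc']
      have hpc' : c'.pc t = .htLoop f last ptr tag c.globalEra := by simp [hc']
      rw [hpc', ← hera]
      simp only [helpRank]
      split
      · -- The failed comparison is one of those counted by `rounds`.
        next hl => rw [rounds_of_ne hl (hera.trans_ne h)]; omega
      · omega
  case htOutput f last tag ret era =>
    split at hc'
    · have hpc' : c'.pc t = .htHandLoad f tag era := by simp [hc']
      refine ⟨by simp [helpRank], by simp [hc'], .inr ⟨by simp [hpc', helpCtx], ?_⟩⟩
      have := writesLeft_le (c'.pc f.i)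
      rw [hpc']
      simp only [helpRank]
      split <;> omega
    · subst hc'
      simp [helpCtx]
      simp [helpRank]
  case htHandLoad f tag era =>
    split at hc'
    · next h =>
      have hpc' : c'.pc t = .htHandSwap f tag era (c.resv f.i (normal f.j)) := by simp [hc']
      have hr : c'.resv f.i (normal f.j) = c.resv f.i (normal f.j) := by simp [hc']
      refine ⟨by simp [helpRank, h], by simp [hc'], .inr ⟨by simp [hpc', helpCtx], ?_⟩⟩
      refine lt_of_lt_of_le ?_ hmono
      rw [hpc']
      simp [helpRank, hr, h]
    · next h =>
      subst hc'
      simp [helpCtx]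
      simp [helpRank, h]
  case htHandSwap f tag era old =>
    split at hc'
    · next h =>
      subst hc'
      simp [helpCtx]
      simp only [helpRank]
      split_ifs <;> omega
    · next h =>
      have hpc' : c'.pc t = .htHandLoad f tag era := by simp [hc']
      have hr : c'.resv f.i (normal f.j) = c.resv f.i (normal f.j) := by simp [hc']
      refine ⟨?_, by simp [hc'], .inr ⟨by simp [hpc', helpCtx], ?_⟩⟩
      · simp only [helpRank]
        split_ifs <;> omega
      refine lt_of_lt_of_le ?_ hmono
      rw [hpc']
      simp only [helpRank, hr, h, if_false]
      split_ifs <;> omega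
  case htLoop f last ptr tag prev =>
    split at hc'
    · next h =>
      have hpc' : c'.pc t = .htPublish f last ptr tag prev := by simp [hc']
      have hr : (c'.state f.i f.j).result = last := by simp [hc', h]
      refine ⟨by simp [helpRank, h], by simp [hc'], .inr ⟨by simp [hpc', helpCtx], ?_⟩⟩
      refine lt_of_lt_of_le ?_ hmono
      rw [hpc']
      simp [helpRank, hr]
    · next h =>
      subst hc'
      simp [helpCtx]
      simp [helpRank, h]
  case htPublish f last ptr tag prev =>
    have hpc' : c'.pc t = .htRead f last ptr tag prev := by simp [hc']
    refine ⟨by simp [helpRank], by simp [hc'], .inr ⟨by simp [hpc', helpCtx], ?_⟩⟩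
    refine lt_of_lt_of_le ?_ hmono
    rw [hpc']
    simp [helpRank]
  case htRead f last ptr tag prev =>
    have hpc' : c'.pc t = .htReread f last ptr tag prev (c.mem ptr) := by simp [hc']
    refine ⟨by simp [helpRank], by simp [hc'], .inr ⟨by simp [hpc', helpCtx], ?_⟩⟩
    refine lt_of_lt_of_le ?_ hmono
    rw [hpc']
    simp [helpRank]
  all_goals
    subst hc'
    (try split) <;> simp [helpCtx, helpRank]

theorem Step.retireRank_lt {P : Params} {t : Fin n} {c c' : Config n H} (hs : Step P t c c')
    (hc : Inv c) (hr : InRetire (c.pc t)) :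
    retireRank c' (c'.retireList t).length (c'.pc t) <
      retireRank c (c.retireList t).length (c.pc t) := by
  cases hf : helpCtx (c.pc t) with
  | some f =>
    -- Within `help_thread`, the rank is `helpRank` plus the cost of what `retire` does afterwards.
    have hrank : retireRank c (c.retireList t).length (c.pc t) =
        blockCost n H * (c.retireList t).length + slotCost n * f.rest.length + 1 +
          helpRank c (c.pc t) := by
      revert hf
      cases c.pc t <;> simp +contextual [helpCtx, retireRank]
    obtain ⟨h0, hl, h | ⟨hf', h⟩⟩ := hs.helpRank_lt hc hf
    · rw [hrank, h, hl, retireRank_ieNext]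
      omega
    · have hrank' : retireRank c' (c'.retireList t).length (c'.pc t) =
          blockCost n H * (c'.retireList t).length + slotCost n * f.rest.length + 1 +
            helpRank c' (c'.pc t) := by
        revert hf'
        cases c'.pc t <;> simp +contextual [helpCtx, retireRank]
      rw [hrank, hrank', hl]
      omega
  | none =>
    have hb : 3 ≤ blockCost n H := by simp [blockCost]
    have hS : 26 ≤ slotCost n := by simp [slotCost]
    obtain rfl := hs.eq_next hr
    cases hpc : c.pc t <;> simp only [hpc, InRetire, helpCtx, reduceCtorEq] at hf hr
    case cuFirst b todo ce scan =>
      cases scan <;> simp only [next, hpc] <;> split <;> simp <;> simp [retireRank] <;> omega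
    case ieScan f i j rest =>
      simp only [next, hpc]
      split
      · simp
        simp [retireRank, helpCtx, helpRank, slotCost, mul_add]
        omega
      · simp
        simp [retireRank, slotCost, mul_add]
    case cuEnd b todo =>
      simp [next, hpc]
      simp [retireRank, blockCost, mul_add]
      omega
    all_goals
      try cases hr
      simp only [next, hpc]
      (repeat' split) <;> simp <;> simp [retireRank, helpCtx, mul_add] <;> omega

/-! ### Executions -/

theorem IsExecution.inv {P : Params} {N : ℕ} {c : ℕ → Config n H} {s : ℕ → Fin n}
    (h : IsExecution P N c s) : ∀ k ≤ N, Inv (c k) := by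
  intro k
  induction k with
  | zero => exact fun _ => .of_isInitial h.1
  | succ k ih => exact fun hk => (ih (by omega)).step (h.2 k hk)

theorem stepCount_succ (s : ℕ → Fin n) (t : Fin n) {k m : ℕ} (h : k ≤ m) :
    stepCount s t k (m + 1) = stepCount s t k m + if s m = t then 1 else 0 := by
  unfold stepCount
  rw [← Finset.insert_Ico_right_eq_Ico_add_one h, Finset.filter_insert]
  split <;> simp

end

end WFE

theorem mainTheorem3 (n H : ℕ) :
    ∃ B C : ℕ, ∀ (P : WFE.Params) (N : ℕ) (c : ℕ → WFE.Config n H) (s : ℕ → Fin n),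
      WFE.IsExecution P N c s →
      ∀ (t : Fin n) (b k : ℕ), (c k).pc t = WFE.PC.rtEnter b →
      ∀ m : ℕ, k ≤ m → m ≤ N → (∀ l : ℕ, k ≤ l → l ≤ m → (c l).pc t ≠ WFE.PC.idle) →
        WFE.stepCount s t k m < B + C * ((c k).retireList t).length ∧
        ∃ c' : WFE.Config n H, WFE.Step P t (c m) c' := by
  refine ⟨WFE.blockCost n H + WFE.slotCost n * (WFE.allSlots n H).length + 8,
    WFE.blockCost n H, ?_⟩
  intro P N c s hex t b k hk m hkm hmN hidle
  have key : WFE.InRetire ((c m).pc t) ∧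
      WFE.stepCount s t k m +
          WFE.retireRank (c m) ((c m).retireList t).length ((c m).pc t) ≤
        WFE.retireRank (c k) ((c k).retireList t).length ((c k).pc t) := by
    induction m, hkm using Nat.le_induction with
    | base => simp [hk, WFE.InRetire, WFE.stepCount]
    | succ m hkm ih =>
      obtain ⟨hr, hle⟩ := ih (by omega) fun l h1 h2 => hidle l h1 (by omega)
      have hs := hex.2 m hmN
      have hc := hex.inv m (by omega)
      rw [WFE.stepCount_succ s t hkm]
      by_cases ht : s m = t
      · rw [ht] at hs
        have hlt := hs.retireRank_lt hc hr
        refine ⟨(hs.inRetire hr).resolve_left (hidle _ (by omega) le_rfl), ?_⟩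
        rw [if_pos ht]
        omega
      · have hle' := hs.retireRank_le hc (Ne.symm ht)
        refine ⟨by rwa [hs.pc_of_ne (Ne.symm ht)], ?_⟩
        rw [if_neg ht]
        omega
  obtain ⟨hr, hle⟩ := key
  refine ⟨?_, _, .run _ hr.ne_idle hr.ne_alMalloc⟩
  simp only [hk, WFE.retireRank, mul_add, mul_one] at hle
  omega
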